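/- Let $m\ge 1$, $n=2^m-1$, $p\in(0,1)$, and let $X=(X_0,\dots,X_{n-1})$ have i.i.d. coordinates in $\{0,1\}$ with $\Pr(X_i=1)=p$; put $\mu(x)=\Pr(X=x)$. Let $r(0)=\sqrt{p/(1-p)}$, $r(1)=-\sqrt{(1-p)/p}$, let $u_S(x)=\prod_{i\in S}r(x_i)$ for $S\subseteq[n]=\{0,\dots,n-1\}$ (an orthonormal basis of $L^2(\{0,1\}^n,\mu)$), and put $\hat g(S)=\mathbb E[g(X)u_S(X)]$ for $g:\{0,1\}^n\to\mathbb R$. For $A\subseteq[n]$ and $f:\{0,1\}^n\to\mathbb R$ let $f_A(x)=\mathbb E[f(X)\mid X_i=x_i\text{ for all }i\in A]$, regarded as a function on $\{0,1\}^n$, and let $\widehat{f_A}(S)$ be its Fourier coefficients. Identify $i\in[n]$ with the nonzero vector $v(i)\in\mathbb F_2^m$ whose entries are the binary digits of $i+1$, least significant first. A function $f$ has $\mathrm{GL}(m,2)$ symmetry if it is invariant under every permutation of its $n$ variables that is induced, through this identification, by an invertible linear transformation of $\mathbb F_2^m$. Let $f:\{0,1\}^n\to\{0,1\}$ have $\mathrm{GL}(m,2)$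 symmetry, and put $\alpha=\mathbb E[f(X)]$, $\lambda=\min\{p,1-p\}$ and $c=1/(8\ln(1/\lambda))$. Let either $0\le \ell<m$ and $A=\{0,1,\dots,2^{m-\ell}-2\}$, or, more generally, $0\le\ell\le m$ and $A=\{i\in[n]: v(i)\in W\}$ for a linear subspace $W\subseteq\mathbb F_2^m$ of codimension $\ell$. Then \[ \sum_{S\subseteq[n]}\widehat{f_A}(S)^2\;\le\;\alpha^2+\alpha\Big(2^{-\ell}\alpha^{1/6}+\big(c\ln(1/\alpha)\big)^{-\ell}\Big). \] (If $\alpha\in\{0,1\}$ and $\ell\ge1$, the term $(c\ln(1/\alpha))^{-\ell}$ is read as $0$; for $\ell=0$ it is $1$.) -/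

import Mathlib

open scoped BigOperators

namespace BooleanCube

/-- The weight of a bit `b` under the Bernoulli distribution with `Pr(1) = p`. -/
def bitWeight (p : ℝ) (b : Bool) : ℝ := if b then p else 1 - p

/-- The product weight `μ(x) = p ^ |x| * (1 - p) ^ (n - |x|)` on `{0,1}ⁿ`. -/
def weight {n : ℕ} (p : ℝ) (x : Fin n → Bool) : ℝ := ∏ i, bitWeight p (x i)

/-- The inner product `⟨f, g⟩_μ = ∑ x, μ(x) f(x) g(x)`. -/
def innerProd {n : ℕ} (p : ℝ) (f g : (Fin n → Bool) → ℝ) : ℝ :=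
  ∑ x, weight p x * f x * g x

/-- The expectation `E[f(X)]`, where `X` has i.i.d. Bernoulli(`p`) coordinates. -/
def expect {n : ℕ} (p : ℝ) (f : (Fin n → Bool) → ℝ) : ℝ :=
  ∑ x, weight p x * f x

/-- The normalized one-bit character: `√(p/(1-p))` at `0` and `-√((1-p)/p)` at `1`. -/
noncomputable def bitChar (p : ℝ) (b : Bool) : ℝ :=
  if b then -Real.sqrt ((1 - p) / p) else Real.sqrt (p / (1 - p))

/-- The orthonormal basis `u_S(x) = ∏_{i ∈ S} r(x_i)` of the `p`-biased cube. -/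
noncomputable def basisFun {n : ℕ} (p : ℝ) (S : Finset (Fin n)) (x : Fin n → Bool) : ℝ :=
  ∏ i ∈ S, bitChar p (x i)

/-- The Fourier coefficient `⟨f, u_S⟩_μ`. -/
noncomputable def fourierCoeff {n : ℕ} (p : ℝ) (f : (Fin n → Bool) → ℝ)
    (S : Finset (Fin n)) : ℝ :=
  innerProd p f (basisFun p S)

/-- The random restriction `f_A(x) = E[f(X) | X_A = x_A]`, as a function on the whole cube that
depends only on the coordinates in `A`. -/
noncomputable def restriction {n : ℕ} (p : ℝ) (A : Finset (Fin n)) (f : (Fin n → Bool) → ℝ)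
    (x : Fin n → Bool) : ℝ :=
  (∑ y with ∀ i ∈ A, y i = x i, weight p y * f y) /
    (∑ y : Fin n → Bool with ∀ i ∈ A, y i = x i, weight p y)

/-- A `{0,1}`-valued function, seen as a real function. -/
def toReal {n : ℕ} (f : (Fin n → Bool) → Bool) (x : Fin n → Bool) : ℝ := if f x then 1 else 0

/-- The symmetry group of `f`: the permutations `π` of the coordinates with `f (π y) = f y` for
all `y`, where `(π y)_i = y_{π⁻¹ i}`. -/
def symGroup {n : ℕ} {Y Z : Type*} (f : (Fin n → Y) → Z) : Subgroup (Equiv.Perm (Fin n)) where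
  carrier := {π | ∀ y : Fin n → Y, f (fun i => y (π⁻¹ i)) = f y}
  one_mem' := fun _ => rfl
  mul_mem' := by
    intro a b ha hb y
    have h := ha (fun i => y (b⁻¹ i))
    rw [hb y] at h
    rw [← h]
    simp [mul_inv_rev]
  inv_mem' := by
    intro a ha y
    have h := ha (fun i => y (a i))
    simpa using h.symm

/-- The vector of `𝔽₂^m` attached to the index `i`: the binary expansion (least significant bit
first) of `i + 1`. This is a bijection from the `2 ^ m - 1` indices to the nonzero vectors. -/
def point (m : ℕ) (i : Fin (2 ^ m - 1)) : Fin m → ZMod 2 :=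
  fun j => if (i.val + 1).testBit j.val then 1 else 0

/-- `GL(m,2)` symmetry: every permutation of the indices that is induced by an invertible linear
transformation of `𝔽₂^m` belongs to the symmetry group of `f`. -/
def HasGLSymmetry (m : ℕ) {Y Z : Type*} (f : (Fin (2 ^ m - 1) → Y) → Z) : Prop :=
  ∀ (g : (Fin m → ZMod 2) ≃ₗ[ZMod 2] (Fin m → ZMod 2)) (π : Equiv.Perm (Fin (2 ^ m - 1))),
    (∀ i, point m (π i) = g (point m i)) → π ∈ symGroup f

/-- The set of indices `{0, 1, …, 2 ^ (m - ℓ) - 2}`. -/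
def initialIndices (m ℓ : ℕ) : Finset (Fin (2 ^ m - 1)) :=
  Finset.univ.filter fun i => i.val < 2 ^ (m - ℓ) - 1

open Classical in
/-- The set of indices whose (nonzero) vectors lie in the subspace `W` of `𝔽₂^m`. -/
noncomputable def subspaceIndices (m : ℕ) (W : Submodule (ZMod 2) (Fin m → ZMod 2)) :
    Finset (Fin (2 ^ m - 1)) :=
  Finset.univ.filter fun i => point m i ∈ W

end BooleanCube

/-! Conditioning on the coordinates in `A` keeps exactly the Fourier coefficients with `S ⊆ A`, so
the sum is the Fourier weight of `f` inside `A` (`fourierCoeff_restriction`). Symmetry makes this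
weight unchanged when a linear bijection `g` moves each `S`. Averaging over `g` therefore replaces
the condition `S ⊆ A` by the probability that a random `g` maps `S` into `W`. If `S` spans dimension
`d`, this is at most `2 ^ (-dℓ)`; the span contains `S` and `0`, so `|S| + 1 ≤ 2 ^ d` and the
probability is at most `(|S| + 1) ^ (-ℓ)` (`card_linearEquiv_mem_mul_le`).

With `K = c ln(1/α)`, three ranges remain. The empty set gives `α ^ 2`. For `1 ≤ |S| ≤ K` the factor
is at most `2 ^ (-ℓ)`, and hypercontractivity bounds the weight by `α ^ (7/6)`
(`sum_fourierCoeff_sq_low_le`). For `|S| > K` the factor is at most `K ^ (-ℓ)`, and Bessel bounds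
the weight by `α`. -/

namespace BooleanCube

/-! ### Expectation and independence on the biased cube. -/

variable {n : ℕ} {p : ℝ}

lemma expect_prod (F : Fin n → Bool → ℝ) :
    expect p (fun x => ∏ i, F i (x i)) = ∏ i, ∑ b, bitWeight p b * F i b := by
  rw [Finset.prod_univ_sum, Fintype.piFinset_univ, expect]
  simp only [weight, Finset.prod_mul_distrib]

lemma sum_bitWeight : ∑ b, bitWeight p b = 1 := by
  simp [bitWeight]

lemma expect_const (r : ℝ) : expect p (fun _ : Fin n → Bool => r) = r := by
  have h := expect_prod (n := n) (p := p) fun _ _ => 1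
  simp only [Finset.prod_const_one, mul_one, sum_bitWeight] at h
  simp only [expect, mul_one] at h
  simp [expect, ← Finset.sum_mul, h]

lemma expect_add (f g : (Fin n → Bool) → ℝ) :
    expect p (fun x => f x + g x) = expect p f + expect p g := by
  simp [expect, mul_add, Finset.sum_add_distrib]

lemma expect_smul (r : ℝ) (f : (Fin n → Bool) → ℝ) :
    expect p (fun x => r * f x) = r * expect p f := by
  simp only [expect, Finset.mul_sum]
  exact Finset.sum_congr rfl fun x _ => by ring

lemma expect_sum {ι : Type*} (s : Finset ι) (f : ι → (Fin n → Bool) → ℝ) :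
    expect p (fun x => ∑ i ∈ s, f i x) = ∑ i ∈ s, expect p (f i) := by
  simp only [expect, Finset.mul_sum]
  exact Finset.sum_comm

lemma bitWeight_pos (hp0 : 0 < p) (hp1 : p < 1) (b : Bool) : 0 < bitWeight p b := by
  cases b <;> simp [bitWeight, hp0, hp1]

lemma weight_pos (hp0 : 0 < p) (hp1 : p < 1) (x : Fin n → Bool) : 0 < weight p x :=
  Finset.prod_pos fun i _ => bitWeight_pos hp0 hp1 (x i)

lemma expect_mono (hp0 : 0 < p) (hp1 : p < 1) {f g : (Fin n → Bool) → ℝ} (h : ∀ x, f x ≤ g x) :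
    expect p f ≤ expect p g :=
  Finset.sum_le_sum fun x _ => mul_le_mul_of_nonneg_left (h x) (weight_pos hp0 hp1 x).le

lemma expect_nonneg (hp0 : 0 < p) (hp1 : p < 1) {f : (Fin n → Bool) → ℝ} (h : ∀ x, 0 ≤ f x) :
    0 ≤ expect p f :=
  Finset.sum_nonneg fun x _ => mul_nonneg (weight_pos hp0 hp1 x).le (h x)

lemma expect_mul_sq_le (hp0 : 0 < p) (hp1 : p < 1) (f g : (Fin n → Bool) → ℝ) :
    expect p (fun x => f x * g x) ^ 2 ≤
      expect p (fun x => f x ^ 2) * expect p (fun x => g x ^ 2) := by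
  have hw := fun x => (weight_pos (n := n) hp0 hp1 x).le
  exact Finset.sum_sq_le_sum_mul_sum_of_sq_le_mul _ (fun x _ => mul_nonneg (hw x) (sq_nonneg _))
    (fun x _ => mul_nonneg (hw x) (sq_nonneg _)) (fun x _ => by ring_nf; rfl)

lemma weight_mul_update (x : Fin n → Bool) (i : Fin n) (b : Bool) :
    weight p (Function.update x i b) * bitWeight p (x i) = weight p x * bitWeight p b := by
  classical
  simp only [weight]
  rw [← Finset.mul_prod_erase _ _ (Finset.mem_univ i),
    ← Finset.mul_prod_erase _ (fun j => bitWeight p (x j)) (Finset.mem_univ i)]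
  rw [Finset.prod_congr rfl fun j hj => by
    rw [Function.update_of_ne (Finset.ne_of_mem_erase hj)]]
  rw [Function.update_self]
  ring

/-- Resampling one coordinate preserves the measure: swapping `x i` with an independent fresh bit is
an involution that keeps the joint weight. -/
lemma expect_eq_expect_sum_update (f : (Fin n → Bool) → ℝ) (i : Fin n) :
    expect p f = expect p fun x => ∑ b, bitWeight p b * f (Function.update x i b) := by
  classical
  have hl : expect p f = ∑ z : (Fin n → Bool) × Bool, weight p z.1 * bitWeight p z.2 * f z.1 := by
    rw [Fintype.sum_prod_type]
    refine Finset.sum_congr rfl fun x _ => ?_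
    simp only
    rw [← Finset.sum_mul, ← Finset.mul_sum, sum_bitWeight, mul_one]
  have hr : (expect p fun x => ∑ b, bitWeight p b * f (Function.update x i b)) =
      ∑ z : (Fin n → Bool) × Bool,
        weight p z.1 * bitWeight p z.2 * f (Function.update z.1 i z.2) := by
    rw [Fintype.sum_prod_type]
    refine Finset.sum_congr rfl fun x _ => ?_
    rw [Finset.mul_sum]
    exact Finset.sum_congr rfl fun b _ => by ring
  have hinv : Function.Involutive fun z : (Fin n → Bool) × Bool =>
      (Function.update z.1 i z.2, z.1 i) := by
    rintro ⟨x, b⟩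
    simp
  rw [hl, hr, ← Equiv.sum_comp hinv.toPerm]
  refine Finset.sum_congr rfl fun z _ => ?_
  simp only [Function.Involutive.coe_toPerm]
  rw [weight_mul_update]

/-- A function of the `i`-th coordinate is independent of a function of the other ones. -/
lemma expect_coord_mul (i : Fin n) (φ : Bool → ℝ) {h : (Fin n → Bool) → ℝ}
    (hh : ∀ x b, h (Function.update x i b) = h x) :
    expect p (fun x => φ (x i) * h x) = (∑ b, bitWeight p b * φ b) * expect p h := by
  rw [expect_eq_expect_sum_update _ i, ← expect_smul]
  congr 1
  funext x
  simp only [Function.update_self, hh, Finset.sum_mul]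
  exact Finset.sum_congr rfl fun b _ => by ring

/-! ### Moments and orthonormality of the biased characters. -/

lemma bitWeight_bitChar (hp0 : 0 < p) (hp1 : p < 1) :
    ∑ b, bitWeight p b * bitChar p b = 0 := by
  have h1 : 0 < 1 - p := sub_pos.2 hp1
  have hs : 0 < Real.sqrt p := Real.sqrt_pos.2 hp0
  have ht : 0 < Real.sqrt (1 - p) := Real.sqrt_pos.2 h1
  have hs2 := Real.sq_sqrt hp0.le
  have ht2 := Real.sq_sqrt h1.le
  simp only [Fintype.sum_bool, bitWeight, bitChar, if_true, Bool.false_eq_true, if_false,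
    Real.sqrt_div h1.le, Real.sqrt_div hp0.le]
  field_simp
  rw [hs2, ht2]
  ring

lemma bitChar_sq_true (hp0 : 0 < p) (hp1 : p < 1) : bitChar p true ^ 2 = (1 - p) / p := by
  simp [bitChar, Real.sq_sqrt (div_nonneg (sub_pos.2 hp1).le hp0.le)]

lemma bitChar_sq_false (hp0 : 0 < p) (hp1 : p < 1) : bitChar p false ^ 2 = p / (1 - p) := by
  simp [bitChar, Real.sq_sqrt (div_nonneg hp0.le (sub_pos.2 hp1).le)]

lemma bitWeight_bitChar_sq (hp0 : 0 < p) (hp1 : p < 1) :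
    ∑ b, bitWeight p b * bitChar p b ^ 2 = 1 := by
  have h1 : 1 - p ≠ 0 := (sub_pos.2 hp1).ne'
  have h0 := hp0.ne'
  rw [Fintype.sum_bool, bitChar_sq_true hp0 hp1, bitChar_sq_false hp0 hp1]
  simp only [bitWeight, if_true, Bool.false_eq_true, if_false]
  field_simp
  ring

/-- Makes `t = λ⁻²` admissible in the hypercontractive inequality. The fourth moment is `1/(p(1-p))
- 3`, and `1/(p(1-p)) ≤ 2/λ`; finally `8/λ ≤ λ⁻⁴` because `λ ≤ 1/2`. -/
lemma bitWeight_bitChar_pow_four_le (hp0 : 0 < p) (hp1 : p < 1) {lam : ℝ}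
    (hlam : lam = min p (1 - p)) :
    3 * ∑ b, bitWeight p b * bitChar p b ^ 4 ≤ ((lam ^ 2)⁻¹) ^ 2 := by
  have h1 : 0 < 1 - p := sub_pos.2 hp1
  have key : ∑ b, bitWeight p b * bitChar p b ^ 4 = (p * (1 - p))⁻¹ - 3 := by
    have h4 : ∀ b, bitChar p b ^ 4 = (bitChar p b ^ 2) ^ 2 := fun b => by ring
    simp only [h4]
    rw [Fintype.sum_bool, bitChar_sq_true hp0 hp1, bitChar_sq_false hp0 hp1]
    simp only [bitWeight, if_true, Bool.false_eq_true, if_false]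
    have h1' := h1.ne'
    field_simp
    ring
  have hl0 : 0 < lam := by rw [hlam]; exact lt_min hp0 h1
  have hl2 : lam ≤ 1 / 2 := by
    rcases le_total p (1 - p) with h | h
    · rw [hlam, min_eq_left h]; linarith
    · rw [hlam, min_eq_right h]; linarith
  have hpp : p * (1 - p) = lam * (1 - lam) := by
    rcases le_total p (1 - p) with h | h
    · rw [hlam, min_eq_left h]
    · rw [hlam, min_eq_right h]; ring
  have hle : (p * (1 - p))⁻¹ ≤ 2 * lam⁻¹ := by
    rw [hpp, mul_inv]
    have : (1 - lam)⁻¹ ≤ 2 := by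
      rw [inv_le_comm₀ (by linarith) (by norm_num)]; linarith
    have := mul_le_mul_of_nonneg_left this (inv_pos.2 hl0).le
    linarith
  have hinv : 2 ≤ lam⁻¹ := by
    rw [le_inv_comm₀ (by norm_num) hl0]; linarith
  have h8 : 8 ≤ lam⁻¹ ^ 3 := by
    have := pow_le_pow_left₀ (by norm_num) hinv 3
    linarith
  have : lam⁻¹ * 8 ≤ ((lam ^ 2)⁻¹) ^ 2 := by
    calc lam⁻¹ * 8 ≤ lam⁻¹ * lam⁻¹ ^ 3 := mul_le_mul_of_nonneg_left h8 (by linarith)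
      _ = ((lam ^ 2)⁻¹) ^ 2 := by rw [← inv_pow]; ring
  rw [key]
  linarith

lemma basisFun_eq_prod (S : Finset (Fin n)) (x : Fin n → Bool) :
    basisFun p S x = ∏ i, if i ∈ S then bitChar p (x i) else 1 := by
  simp [basisFun, Finset.prod_ite_mem]

lemma expect_basisFun_mul (hp0 : 0 < p) (hp1 : p < 1) (S T : Finset (Fin n)) :
    expect p (fun x => basisFun p S x * basisFun p T x) = if S = T then 1 else 0 := by
  have h := expect_prod (n := n) (p := p) fun i b =>
    (if i ∈ S then bitChar p b else 1) * (if i ∈ T then bitChar p b else 1)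
  simp only [Finset.prod_mul_distrib, ← basisFun_eq_prod] at h
  rw [h]
  split_ifs with hST
  · subst hST
    refine Finset.prod_eq_one fun i _ => ?_
    by_cases hi : i ∈ S
    · simpa [hi, sq] using bitWeight_bitChar_sq hp0 hp1
    · simpa [hi] using sum_bitWeight (p := p)
  · obtain ⟨i, hi⟩ : ∃ i, ¬(i ∈ S ↔ i ∈ T) := by
      by_contra! hc
      exact hST (Finset.ext hc)
    refine Finset.prod_eq_zero (Finset.mem_univ i) ?_
    have := bitWeight_bitChar hp0 hp1
    by_cases hS : i ∈ S <;> by_cases hT : i ∈ T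
    · exact absurd (by simp [hS, hT]) hi
    · simpa [hS, hT] using this
    · simpa [hS, hT] using this
    · exact absurd (by simp [hS, hT]) hi

lemma basisFun_insert {S : Finset (Fin n)} {i : Fin n} (hi : i ∉ S) (x : Fin n → Bool) :
    basisFun p (insert i S) x = bitChar p (x i) * basisFun p S x :=
  Finset.prod_insert hi

lemma basisFun_update {S : Finset (Fin n)} {i : Fin n} (hi : i ∉ S) (x : Fin n → Bool) (b : Bool) :
    basisFun p S (Function.update x i b) = basisFun p S x :=
  Finset.prod_congr rfl fun j hj => by
    rw [Function.update_of_ne (ne_of_mem_of_not_mem hj hi)]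

/-! ### Hypercontractivity, Bessel and the level inequality. -/

lemma fourierCoeff_eq_expect (f : (Fin n → Bool) → ℝ) (S : Finset (Fin n)) :
    fourierCoeff p f S = expect p fun x => f x * basisFun p S x := by
  simp only [fourierCoeff, innerProd, expect, mul_assoc]

/-- One step of the `(2,4)`-hypercontractive inequality. -/
lemma expect_pow_four_step (hp0 : 0 < p) (hp1 : p < 1) {t : ℝ} (ht : 4 ≤ t)
    (hR : 3 * ∑ b, bitWeight p b * bitChar p b ^ 4 ≤ t ^ 2) (i : Fin n)
    {a b : (Fin n → Bool) → ℝ} (ha : ∀ x c, a (Function.update x i c) = a x)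
    (hb : ∀ x c, b (Function.update x i c) = b x) {A B : ℝ} (hA : 0 ≤ A) (hB : 0 ≤ B)
    (hAa : expect p (fun x => a x ^ 4) ≤ A ^ 2) (hBb : expect p (fun x => b x ^ 4) ≤ B ^ 2) :
    expect p (fun x => (a x + bitChar p (x i) * b x) ^ 4) ≤ (A + t * B) ^ 2 := by
  -- The third moment of the character need not vanish, so with `y = a` and `z = r b` the term
  -- `4yz³` is absorbed by `2y²z² + 2z⁴`, turning the coefficients 6 and 1 into 8 and 3.
  have hpt : ∀ x, (a x + bitChar p (x i) * b x) ^ 4 ≤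
      ((a x ^ 4 + bitChar p (x i) * (4 * (a x ^ 3 * b x))) +
        bitChar p (x i) ^ 2 * (8 * (a x ^ 2 * b x ^ 2))) +
        bitChar p (x i) ^ 4 * (3 * b x ^ 4) := fun x => by
    nlinarith [sq_nonneg (a x * b x * bitChar p (x i) - (b x * bitChar p (x i)) ^ 2)]
  refine (expect_mono hp0 hp1 hpt).trans ?_
  rw [expect_add, expect_add, expect_add,
    expect_coord_mul i (bitChar p) (by intro x c; simp only [ha, hb]),
    expect_coord_mul i (fun c => bitChar p c ^ 2) (by intro x c; simp only [ha, hb]),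
    expect_coord_mul i (fun c => bitChar p c ^ 4) (by intro x c; simp only [hb]),
    bitWeight_bitChar hp0 hp1, bitWeight_bitChar_sq hp0 hp1, expect_smul, expect_smul, expect_smul]
  have hab : expect p (fun x => a x ^ 2 * b x ^ 2) ≤ A * B := by
    refine abs_le_of_sq_le_sq' ?_ (mul_nonneg hA hB) |>.2
    refine (expect_mul_sq_le hp0 hp1 _ _).trans ?_
    simp only [← pow_mul]
    rw [mul_pow]
    exact mul_le_mul hAa hBb (expect_nonneg hp0 hp1 fun x => (by positivity : 0 ≤ b x ^ 4))
      (sq_nonneg _)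
  have hb0 : 0 ≤ expect p (fun x => b x ^ 4) := expect_nonneg hp0 hp1 fun x => by positivity
  have h1 := (mul_le_mul_of_nonneg_right hR hb0).trans
    (mul_le_mul_of_nonneg_left hBb (sq_nonneg t))
  -- `t ≥ 4` fits `8AB` into the cross term `2tAB` of the target.
  have h2 := mul_le_mul_of_nonneg_right ht (mul_nonneg hA hB)
  nlinarith

/-- The `(2,4)`-hypercontractive inequality for the biased cube. -/
lemma expect_sum_basisFun_pow_four_le (hp0 : 0 < p) (hp1 : p < 1) {t : ℝ} (ht : 4 ≤ t)
    (hR : 3 * ∑ b, bitWeight p b * bitChar p b ^ 4 ≤ t ^ 2) (I : Finset (Fin n))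
    (a : Finset (Fin n) → ℝ) :
    expect p (fun x => (∑ S ∈ I.powerset, a S * basisFun p S x) ^ 4) ≤
      (∑ S ∈ I.powerset, t ^ S.card * a S ^ 2) ^ 2 := by
  classical
  induction I using Finset.induction_on generalizing a with
  | empty => simp [basisFun, expect_const, ← pow_mul]
  | insert i I hi ih =>
    have hmem : ∀ S ∈ I.powerset, i ∉ S := fun S hS h => hi (Finset.mem_powerset.1 hS h)
    have hupd : ∀ (c : Finset (Fin n) → ℝ) (x : Fin n → Bool) (b : Bool),
        ∑ S ∈ I.powerset, c S * basisFun p S (Function.update x i b) =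
          ∑ S ∈ I.powerset, c S * basisFun p S x := fun c x b =>
      Finset.sum_congr rfl fun S hS => by rw [basisFun_update (hmem S hS)]
    have hnn : ∀ c : Finset (Fin n) → ℝ, 0 ≤ ∑ S ∈ I.powerset, t ^ S.card * c S ^ 2 := fun c =>
      Finset.sum_nonneg fun S _ => mul_nonneg (pow_nonneg (by linarith) _) (sq_nonneg _)
    -- Splitting by whether `i ∈ S` writes the sum as `a + r(x_i) b`, with `a` and `b` independent
    -- of coordinate `i`.
    have h := expect_pow_four_step hp0 hp1 ht hR i (hupd a) (hupd fun S => a (insert i S))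
      (hnn a) (hnn _) (ih a) (ih _)
    convert h using 3
    · rename_i x
      rw [Finset.sum_powerset_insert hi, Finset.mul_sum]
      congr 2
      exact Finset.sum_congr rfl fun S hS => by rw [basisFun_insert (hmem S hS)]; ring
    · rw [Finset.sum_powerset_insert hi, Finset.mul_sum]
      congr 1
      exact Finset.sum_congr rfl fun S hS => by
        rw [Finset.card_insert_of_notMem (hmem S hS)]; ring

lemma expect_mul_sum_basisFun (f : (Fin n → Bool) → ℝ) (P : Finset (Finset (Fin n)))
    (a : Finset (Fin n) → ℝ) :
    expect p (fun x => f x * ∑ S ∈ P, a S * basisFun p S x) =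
      ∑ S ∈ P, a S * fourierCoeff p f S := by
  simp only [Finset.mul_sum, fourierCoeff_eq_expect, ← expect_smul]
  rw [expect_sum]
  exact Finset.sum_congr rfl fun S _ => by congr 1; funext x; ring

lemma fourierCoeff_sum_basisFun (hp0 : 0 < p) (hp1 : p < 1) (P : Finset (Finset (Fin n)))
    (a : Finset (Fin n) → ℝ) {T : Finset (Fin n)} (hT : T ∈ P) :
    fourierCoeff p (fun x => ∑ S ∈ P, a S * basisFun p S x) T = a T := by
  simp only [fourierCoeff_eq_expect, Finset.sum_mul]
  rw [expect_sum]
  simp only [mul_assoc, expect_smul, expect_basisFun_mul hp0 hp1]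
  simp [hT]

/-- Bessel's inequality. -/
lemma sum_fourierCoeff_sq_le (hp0 : 0 < p) (hp1 : p < 1) (f : (Fin n → Bool) → ℝ)
    (P : Finset (Finset (Fin n))) :
    ∑ S ∈ P, fourierCoeff p f S ^ 2 ≤ expect p fun x => f x ^ 2 := by
  set g := fun x => ∑ S ∈ P, fourierCoeff p f S * basisFun p S x with hg
  have hfg : expect p (fun x => f x * g x) = ∑ S ∈ P, fourierCoeff p f S ^ 2 := by
    rw [hg, expect_mul_sum_basisFun]
    exact Finset.sum_congr rfl fun S _ => (sq _).symm
  have hgg : expect p (fun x => g x * g x) = ∑ S ∈ P, fourierCoeff p f S ^ 2 := by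
    conv_lhs => rw [hg]
    rw [expect_mul_sum_basisFun]
    refine Finset.sum_congr rfl fun S hS => ?_
    rw [fourierCoeff_sum_basisFun hp0 hp1 P _ hS, sq]
  have h0 := expect_nonneg hp0 hp1 fun x => sq_nonneg (f x - g x)
  have : expect p (fun x => (f x - g x) ^ 2) = expect p (fun x => f x ^ 2) +
      (-2 * expect p (fun x => f x * g x) + expect p fun x => g x * g x) := by
    rw [← expect_smul, ← expect_add, ← expect_add]
    congr 1; funext x; ring
  rw [this, hfg, hgg] at h0
  linarith

lemma expect_toReal_nonneg (hp0 : 0 < p) (hp1 : p < 1) (f : (Fin n → Bool) → Bool) :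
    0 ≤ expect p (toReal f) :=
  expect_nonneg hp0 hp1 fun x => by unfold toReal; split_ifs <;> norm_num

lemma expect_toReal_le_one (hp0 : 0 < p) (hp1 : p < 1) (f : (Fin n → Bool) → Bool) :
    expect p (toReal f) ≤ 1 := by
  rw [← expect_const (n := n) (p := p) 1]
  exact expect_mono hp0 hp1 fun x => by unfold toReal; split_ifs <;> norm_num

lemma toReal_sq (f : (Fin n → Bool) → Bool) (x : Fin n → Bool) : toReal f x ^ 2 = toReal f x := by
  unfold toReal; split_ifs <;> norm_num

/-- A level inequality: if `t ^ |S| ≤ M` on `P`, the Fourier weight of `f` on `P` is small. -/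
lemma sum_fourierCoeff_sq_sq_le (hp0 : 0 < p) (hp1 : p < 1) {t M : ℝ} (ht : 4 ≤ t)
    (hR : 3 * ∑ b, bitWeight p b * bitChar p b ^ 4 ≤ t ^ 2) (f : (Fin n → Bool) → Bool)
    (P : Finset (Finset (Fin n))) (hM : ∀ S ∈ P, t ^ S.card ≤ M) :
    (∑ S ∈ P, fourierCoeff p (toReal f) S ^ 2) ^ 2 ≤ expect p (toReal f) ^ 3 * M ^ 2 := by
  classical
  set F := toReal f
  set α := expect p F with hα
  set W := ∑ S ∈ P, fourierCoeff p F S ^ 2 with hW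
  have hα0 : 0 ≤ α := expect_toReal_nonneg hp0 hp1 f
  have hW0 : 0 ≤ W := Finset.sum_nonneg fun S _ => sq_nonneg _
  rcases hW0.eq_or_lt with h | hWpos
  · rw [← h, zero_pow two_ne_zero]; positivity
  set g := fun x => ∑ S ∈ P, fourierCoeff p F S * basisFun p S x with hg
  have hfg : expect p (fun x => F x * g x) = W := by
    rw [hg, expect_mul_sum_basisFun]
    exact Finset.sum_congr rfl fun S _ => (sq _).symm
  have hg4 : expect p (fun x => g x ^ 4) ≤ (M * W) ^ 2 := by
    have h := expect_sum_basisFun_pow_four_le hp0 hp1 ht hR Finset.univ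
      fun S => if S ∈ P then fourierCoeff p F S else 0
    simp only [Finset.powerset_univ, ite_mul, zero_mul, ite_pow, ne_eq, OfNat.ofNat_ne_zero,
      not_false_eq_true, zero_pow, mul_ite, mul_zero, Finset.sum_ite_mem, Finset.univ_inter] at h
    refine h.trans (pow_le_pow_left₀ (Finset.sum_nonneg fun S _ =>
      mul_nonneg (pow_nonneg (by linarith) _) (sq_nonneg _)) ?_ 2)
    rw [hW, Finset.mul_sum]
    exact Finset.sum_le_sum fun S hS => mul_le_mul_of_nonneg_right (hM S hS) (sq_nonneg _)
  have hF2 : expect p (fun x => F x ^ 2) = α := by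
    rw [hα]; congr 1; funext x; exact toReal_sq f x
  -- Since `F² = F`, Cauchy–Schwarz applies to `F · (F g)` and then to `F · g²`; each use gains a
  -- factor of the mean `α`.
  have h1 : W ^ 2 ≤ α * expect p (fun x => F x * g x ^ 2) := by
    have h := expect_mul_sq_le hp0 hp1 F fun x => F x * g x
    have e1 : (fun x => F x * (F x * g x)) = fun x => F x * g x := by
      funext x; rw [← mul_assoc, ← sq, toReal_sq]
    have e2 : (fun x => (F x * g x) ^ 2) = fun x => F x * g x ^ 2 := by
      funext x; rw [mul_pow, toReal_sq]
    rwa [e1, e2, hfg, hF2] at h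
  have h2 : expect p (fun x => F x * g x ^ 2) ^ 2 ≤ α * (M * W) ^ 2 := by
    have h := expect_mul_sq_le hp0 hp1 F fun x => g x ^ 2
    simp only [← pow_mul] at h
    rw [hF2] at h
    exact h.trans (mul_le_mul_of_nonneg_left hg4 hα0)
  have h3 : W ^ 2 * W ^ 2 ≤ W ^ 2 * (α ^ 3 * M ^ 2) := by
    calc W ^ 2 * W ^ 2 = (W ^ 2) ^ 2 := by ring
      _ ≤ (α * expect p (fun x => F x * g x ^ 2)) ^ 2 := pow_le_pow_left₀ (sq_nonneg _) h1 2
      _ = α ^ 2 * expect p (fun x => F x * g x ^ 2) ^ 2 := by ring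
      _ ≤ α ^ 2 * (α * (M * W) ^ 2) := mul_le_mul_of_nonneg_left h2 (sq_nonneg _)
      _ = W ^ 2 * (α ^ 3 * M ^ 2) := by ring
  exact le_of_mul_le_mul_left h3 (by positivity)

/-! ### Fourier coefficients under conditioning and under symmetry. -/

lemma basisFun_congr {A S : Finset (Fin n)} (hS : S ⊆ A) {x y : Fin n → Bool}
    (h : ∀ i ∈ A, x i = y i) : basisFun p S x = basisFun p S y :=
  Finset.prod_congr rfl fun i hi => by rw [h i (hS hi)]

lemma restriction_congr {A : Finset (Fin n)} (f : (Fin n → Bool) → ℝ) {x y : Fin n → Bool}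
    (h : ∀ i ∈ A, x i = y i) : restriction p A f x = restriction p A f y := by
  have : ∀ z : Fin n → Bool, (∀ i ∈ A, z i = x i) ↔ ∀ i ∈ A, z i = y i := fun z =>
    forall₂_congr fun i hi => by rw [h i hi]
  simp only [restriction, this]

/-- The defining property of the conditional expectation. -/
lemma expect_restriction_mul (hp0 : 0 < p) (hp1 : p < 1) {A : Finset (Fin n)}
    (f : (Fin n → Bool) → ℝ) {h : (Fin n → Bool) → ℝ}
    (hh : ∀ x y : Fin n → Bool, (∀ i ∈ A, x i = y i) → h x = h y) :
    expect p (fun x => restriction p A f x * h x) = expect p fun x => f x * h x := by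
  set D : (Fin n → Bool) → ℝ := fun x => ∑ y with ∀ i ∈ A, y i = x i, weight p y with hD
  have hDpos : ∀ x, 0 < D x := fun x =>
    Finset.sum_pos (fun y _ => weight_pos hp0 hp1 y) ⟨x, by simp⟩
  have hDc : ∀ x y : Fin n → Bool, (∀ i ∈ A, x i = y i) → D x = D y := fun x y hxy => by
    have : ∀ z : Fin n → Bool, (∀ i ∈ A, z i = x i) ↔ ∀ i ∈ A, z i = y i := fun z =>
      forall₂_congr fun i hi => by rw [hxy i hi]
    simp only [hD, this]
  calc expect p (fun x => restriction p A f x * h x)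
      = ∑ x, ∑ y, if ∀ i ∈ A, y i = x i then
          weight p x * (weight p y * f y / D x * h x) else 0 := by
        refine Finset.sum_congr rfl fun x _ => ?_
        change weight p x * (restriction p A f x * h x) = _
        rw [← Finset.sum_filter, restriction, Finset.sum_div, Finset.sum_mul, Finset.mul_sum]
    _ = ∑ y, ∑ x, if ∀ i ∈ A, y i = x i then
          weight p x * (weight p y * f y / D x * h x) else 0 := Finset.sum_comm
    _ = expect p fun x => f x * h x := by
        refine Finset.sum_congr rfl fun y _ => ?_
        rw [← Finset.sum_filter]
        have e1 : ∀ x ∈ Finset.univ.filter (fun x : Fin n → Bool => ∀ i ∈ A, y i = x i),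
            weight p x * (weight p y * f y / D x * h x) =
              weight p x * (weight p y * f y / D y * h y) := fun x hx => by
          have hx' := (Finset.mem_filter.1 hx).2
          rw [hDc y x hx', hh y x hx']
        rw [Finset.sum_congr rfl e1, ← Finset.sum_mul]
        have e2 : ∑ x : Fin n → Bool with ∀ i ∈ A, y i = x i, weight p x = D y := by
          simp only [hD, eq_comm]
        rw [e2]
        field_simp [(hDpos y).ne']

/-- For `S ⊆ A` the character depends only on `A`, so conditioning is invisible. Otherwise a
coordinate in `S \ A` contributes an independent factor of mean zero. -/
lemma fourierCoeff_restriction (hp0 : 0 < p) (hp1 : p < 1) (A S : Finset (Fin n))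
    (f : (Fin n → Bool) → ℝ) :
    fourierCoeff p (restriction p A f) S = if S ⊆ A then fourierCoeff p f S else 0 := by
  split_ifs with hS
  · rw [fourierCoeff_eq_expect, fourierCoeff_eq_expect]
    exact expect_restriction_mul hp0 hp1 f fun x y h => basisFun_congr hS h
  · obtain ⟨i, hiS, hiA⟩ := Finset.not_subset.1 hS
    have hins := Finset.insert_erase hiS
    have hni : i ∉ S.erase i := Finset.notMem_erase i S
    have e : (fun x => restriction p A f x * basisFun p S x) = fun x =>
        bitChar p (x i) * (restriction p A f x * basisFun p (S.erase i) x) := by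
      funext x
      rw [← hins, basisFun_insert hni, hins]
      ring
    rw [fourierCoeff_eq_expect, e, expect_coord_mul i (bitChar p), bitWeight_bitChar hp0 hp1,
      zero_mul]
    intro x b
    rw [basisFun_update hni, restriction_congr f (y := x)]
    intro j hj
    rw [Function.update_of_ne (ne_of_mem_of_not_mem hj hiA)]

lemma sum_fourierCoeff_restriction_sq (hp0 : 0 < p) (hp1 : p < 1) (A : Finset (Fin n))
    (f : (Fin n → Bool) → ℝ) :
    ∑ S, fourierCoeff p (restriction p A f) S ^ 2 =
      ∑ S, if S ⊆ A then fourierCoeff p f S ^ 2 else 0 :=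
  Finset.sum_congr rfl fun S _ => by
    rw [fourierCoeff_restriction hp0 hp1]
    split_ifs <;> simp

lemma fourierCoeff_map {f : (Fin n → Bool) → Bool} {π : Equiv.Perm (Fin n)}
    (hπ : π ∈ symGroup f) (S : Finset (Fin n)) :
    fourierCoeff p (toReal f) (S.map π.toEmbedding) = fourierCoeff p (toReal f) S := by
  rw [fourierCoeff_eq_expect, fourierCoeff_eq_expect, expect, expect]
  rw [← Equiv.sum_comp (Equiv.arrowCongr π (Equiv.refl Bool))]
  refine Finset.sum_congr rfl fun x _ => ?_
  have hx : (Equiv.arrowCongr π (Equiv.refl Bool)) x = fun i => x (π⁻¹ i) := rfl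
  have hf : toReal f (fun i => x (π⁻¹ i)) = toReal f x := by
    unfold toReal; rw [hπ x]
  have hw : weight p (fun i => x (π⁻¹ i)) = weight p x :=
    Equiv.prod_comp π⁻¹ fun i => bitWeight p (x i)
  rw [hx, hf, hw]
  simp [basisFun]

end BooleanCube

namespace BooleanCube

/-! ### Counting linear bijections that send a set into a subspace. -/

section Counting

open Module

variable {K V : Type*} [Field K] [AddCommGroup V] [Module K V]

/-- The general linear group acts transitively on linearly independent tuples. -/
lemma exists_linearEquiv_apply_eq [FiniteDimensional K V] {d : ℕ} {s t : Fin d → V}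
    (hs : LinearIndependent K s) (ht : LinearIndependent K t) :
    ∃ h : V ≃ₗ[K] V, ∀ i, h (s i) = t i := by
  obtain ⟨h, hh⟩ := Submodule.exists_linearEquiv_restrict_eq
    (hs.linearCombinationEquiv.symm.trans ht.linearCombinationEquiv)
  refine ⟨h, fun i => ?_⟩
  have key := hh (hs.linearCombinationEquiv (Finsupp.single i 1))
  simpa using key.symm

instance finite_linearEquiv [Finite V] : Finite (V ≃ₗ[K] V) :=
  Finite.of_injective (fun g : V ≃ₗ[K] V => (g : V → V)) DFunLike.coe_injective

open Classical in
-- Compare the product formulas factor by factor: with `q = |K|`, `(q ^ dim W - q ^ i) q ^ l = q ^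
-- dim V - q ^ (i + l) ≤ q ^ dim V - q ^ i`. If `d > dim W`, no tuple lies in `W`.
lemma card_linearIndependent_mem_mul_le [Fintype K] [Fintype V] (W : Submodule K V) {l : ℕ}
    (hl : finrank K W + l = finrank K V) {d : ℕ} (hd : d ≤ finrank K V) :
    (Finset.univ.filter fun t : Fin d → V => LinearIndependent K t ∧ ∀ i, t i ∈ W).card *
        Fintype.card K ^ (d * l) ≤
      (Finset.univ.filter fun t : Fin d → V => LinearIndependent K t).card := by
  have hW : (Finset.univ.filter fun t : Fin d → V => LinearIndependent K t ∧ ∀ i, t i ∈ W).card ≤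
      Nat.card {t : Fin d → W // LinearIndependent K t} := by
    rw [← Fintype.card_subtype, ← Nat.card_eq_fintype_card]
    refine Nat.card_le_card_of_injective (fun t => ⟨fun i => ⟨t.1 i, t.2.2 i⟩,
      LinearIndependent.of_comp W.subtype t.2.1⟩) fun t t' h => ?_
    ext i
    exact congrArg (fun z => ((z.1 i : W) : V)) h
  have hV : (Finset.univ.filter fun t : Fin d → V => LinearIndependent K t).card =
      Nat.card {t : Fin d → V // LinearIndependent K t} := by
    rw [← Fintype.card_subtype, ← Nat.card_eq_fintype_card]
  rw [hV]
  refine (Nat.mul_le_mul_right _ hW).trans ?_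
  by_cases hdW : d ≤ finrank K W
  · rw [card_linearIndependent hdW, card_linearIndependent hd, mul_comm d l, pow_mul]
    have : (Fintype.card K ^ l) ^ d = ∏ _i : Fin d, Fintype.card K ^ l := by simp
    rw [this, ← Finset.prod_mul_distrib]
    refine Finset.prod_le_prod' fun i _ => ?_
    rw [Nat.sub_mul, ← hl, pow_add]
    exact Nat.sub_le_sub_left (Nat.le_mul_of_pos_right _ (pow_pos Fintype.card_pos _)) _
  · have : IsEmpty {t : Fin d → W // LinearIndependent K t} := by
      refine ⟨fun t => hdW ?_⟩
      simpa using t.2.fintype_card_le_finrank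
    simp

open Classical in
-- By transitivity, `g ↦ g ∘ s` has fibres of equal size over all independent tuples, so counting
-- maps reduces to counting tuples.
lemma card_linearEquiv_tuple_mem_mul_le [Fintype K] [Fintype V] [Fintype (V ≃ₗ[K] V)]
    (W : Submodule K V) {l : ℕ} (hl : finrank K W + l = finrank K V) {d : ℕ} {s : Fin d → V}
    (hs : LinearIndependent K s) :
    (Finset.univ.filter fun g : V ≃ₗ[K] V => ∀ i, g (s i) ∈ W).card * Fintype.card K ^ (d * l) ≤
      Fintype.card (V ≃ₗ[K] V) := by
  have hfib : ∀ t : Fin d → V, LinearIndependent K t →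
      (Finset.univ.filter fun g : V ≃ₗ[K] V => (fun i => g (s i)) = t).card =
        (Finset.univ.filter fun g : V ≃ₗ[K] V => (fun i => g (s i)) = s).card := fun t ht => by
    obtain ⟨h, hh⟩ := exists_linearEquiv_apply_eq hs ht
    refine Finset.card_bij' (fun g _ => g.trans h.symm) (fun g _ => g.trans h) ?_ ?_ ?_ ?_
    · intro g hg
      have hg' := (Finset.mem_filter.1 hg).2
      refine Finset.mem_filter.2 ⟨Finset.mem_univ _, ?_⟩
      funext i
      have := congrFun hg' i
      simp only [LinearEquiv.trans_apply] at this ⊢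
      rw [this, ← hh, LinearEquiv.symm_apply_apply]
    · intro g hg
      have hg' := (Finset.mem_filter.1 hg).2
      refine Finset.mem_filter.2 ⟨Finset.mem_univ _, ?_⟩
      funext i
      have := congrFun hg' i
      simp only [LinearEquiv.trans_apply] at this ⊢
      rw [this, hh]
    · intro g _; ext v; simp
    · intro g _; ext v; simp
  have hli : ∀ g : V ≃ₗ[K] V, LinearIndependent K fun i => g (s i) := fun g =>
    hs.map' (g : V →ₗ[K] V) g.ker
  set k := (Finset.univ.filter fun g : V ≃ₗ[K] V => (fun i => g (s i)) = s).card
  have h1 : Fintype.card (V ≃ₗ[K] V) =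
      (Finset.univ.filter fun t : Fin d → V => LinearIndependent K t).card * k := by
    rw [← Finset.card_univ, Finset.card_eq_sum_card_fiberwise
      (f := fun (g : V ≃ₗ[K] V) i => g (s i))
      (t := Finset.univ.filter fun t : Fin d → V => LinearIndependent K t)
      fun g _ => by simpa using hli g]
    rw [Finset.sum_congr rfl fun t ht => hfib t (Finset.mem_filter.1 ht).2]
    simp
  have h2 : (Finset.univ.filter fun g : V ≃ₗ[K] V => ∀ i, g (s i) ∈ W).card =
      (Finset.univ.filter fun t : Fin d → V => LinearIndependent K t ∧ ∀ i, t i ∈ W).card * k := by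
    rw [Finset.card_eq_sum_card_fiberwise
      (f := fun (g : V ≃ₗ[K] V) i => g (s i))
      (t := Finset.univ.filter fun t : Fin d → V => LinearIndependent K t ∧ ∀ i, t i ∈ W)
      fun g hg => by simpa using ⟨hli g, by simpa using hg⟩]
    rw [Finset.sum_congr rfl fun t ht => ?_, Finset.sum_const, smul_eq_mul]
    have ht' := (Finset.mem_filter.1 ht).2
    rw [← hfib t ht'.1, Finset.filter_filter]
    congr 1
    refine Finset.filter_congr fun g _ => and_iff_right_of_imp ?_
    rintro rfl
    exact ht'.2
  rw [h1, h2, mul_right_comm]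
  refine Nat.mul_le_mul_right _ (card_linearIndependent_mem_mul_le W hl ?_)
  simpa using hs.fintype_card_le_finrank

open Classical in
-- Apply the tuple bound to a basis of the span of `S`. The `+ 1` counts the zero vector, which the
-- span contains and `S` does not.
lemma card_linearEquiv_mem_mul_le [Fintype K] [Fintype V] [Fintype (V ≃ₗ[K] V)]
    (W : Submodule K V) {l : ℕ} (hl : finrank K W + l = finrank K V) (S : Finset V)
    (hS : (0 : V) ∉ S) :
    (Finset.univ.filter fun g : V ≃ₗ[K] V => ∀ v ∈ S, g v ∈ W).card * (S.card + 1) ^ l ≤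
      Fintype.card (V ≃ₗ[K] V) := by
  set U := Submodule.span K (S : Set V) with hU
  set b := finBasis K U
  have hs : LinearIndependent K fun i => (b i : V) :=
    b.linearIndependent.map' U.subtype U.ker_subtype
  have hcard : S.card + 1 ≤ Fintype.card K ^ finrank K U := by
    rw [← Module.card_eq_pow_finrank (K := K) (V := U), ← Finset.card_insert_of_notMem hS,
      Fintype.card_subtype]
    refine Finset.card_le_card fun v hv => ?_
    rw [Finset.mem_filter]
    refine ⟨Finset.mem_univ _, ?_⟩
    rcases Finset.mem_insert.1 hv with rfl | hv
    · exact U.zero_mem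
    · exact Submodule.subset_span hv
  refine le_trans ?_ (card_linearEquiv_tuple_mem_mul_le W hl hs)
  rw [pow_mul]
  refine Nat.mul_le_mul (Finset.card_le_card fun g hg => ?_) (Nat.pow_le_pow_left hcard l)
  have hg' := (Finset.mem_filter.1 hg).2
  refine Finset.mem_filter.2 ⟨Finset.mem_univ _, fun i => ?_⟩
  have : U ≤ W.comap (g : V →ₗ[K] V) := Submodule.span_le.2 fun v hv => hg' v hv
  exact this (b i).2

end Counting

/-! ### Indices as nonzero vectors, and averaging over the group. -/

section Points

variable {m : ℕ}

lemma lt_two_pow_of_index (i : Fin (2 ^ m - 1)) : i.val + 1 < 2 ^ m := by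
  have := i.2
  omega

lemma point_apply_eq_zero_iff (i : Fin (2 ^ m - 1)) (j : Fin m) :
    point m i j = 0 ↔ (i.val + 1).testBit j.val = false := by
  unfold point
  split_ifs with h <;> simp [h]

lemma point_injective : Function.Injective (point m) := by
  intro i i' h
  have : i.val + 1 = i'.val + 1 := by
    refine Nat.eq_of_testBit_eq fun j => ?_
    by_cases hj : j < m
    · have h1 := point_apply_eq_zero_iff i ⟨j, hj⟩
      rw [h, point_apply_eq_zero_iff] at h1
      simp only at h1
      cases h2 : (i.val + 1).testBit j <;> simp_all
    · have hle : 2 ^ m ≤ 2 ^ j := Nat.pow_le_pow_right two_pos (not_lt.1 hj)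
      rw [Nat.testBit_lt_two_pow ((lt_two_pow_of_index i).trans_le hle),
        Nat.testBit_lt_two_pow ((lt_two_pow_of_index i').trans_le hle)]
  exact Fin.ext (by omega)

lemma point_ne_zero (i : Fin (2 ^ m - 1)) : point m i ≠ 0 := by
  intro h
  have : i.val + 1 = 0 := by
    refine Nat.eq_of_testBit_eq fun j => ?_
    rw [Nat.zero_testBit]
    by_cases hj : j < m
    · exact (point_apply_eq_zero_iff i ⟨j, hj⟩).1 (congrFun h _)
    · exact Nat.testBit_lt_two_pow ((lt_two_pow_of_index i).trans_le
        (Nat.pow_le_pow_right two_pos (not_lt.1 hj)))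
  omega

lemma exists_point_eq {v : Fin m → ZMod 2} (hv : v ≠ 0) : ∃ i, point m i = v := by
  classical
  have hb : Function.Bijective fun i : Fin (2 ^ m - 1) =>
      (⟨point m i, point_ne_zero i⟩ : {v : Fin m → ZMod 2 // v ≠ 0}) := by
    rw [Fintype.bijective_iff_injective_and_card]
    refine ⟨fun i i' h => point_injective (congrArg Subtype.val h), ?_⟩
    simp [Fintype.card_subtype_compl]
  obtain ⟨i, hi⟩ := hb.2 ⟨v, hv⟩
  exact ⟨i, congrArg Subtype.val hi⟩

lemma exists_perm_point (g : (Fin m → ZMod 2) ≃ₗ[ZMod 2] (Fin m → ZMod 2)) :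
    ∃ π : Equiv.Perm (Fin (2 ^ m - 1)), ∀ i, point m (π i) = g (point m i) := by
  have h : ∀ i, ∃ j, point m j = g (point m i) := fun i =>
    exists_point_eq (by simpa using point_ne_zero i)
  choose φ hφ using h
  have hinj : Function.Injective φ := fun i i' hii => by
    have := (hφ i).symm.trans ((congrArg (point m) hii).trans (hφ i'))
    exact point_injective (g.injective this)
  exact ⟨Equiv.ofBijective φ (Finite.injective_iff_bijective.1 hinj), hφ⟩

lemma mem_subspaceIndices {W : Submodule (ZMod 2) (Fin m → ZMod 2)} {i : Fin (2 ^ m - 1)} :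
    i ∈ subspaceIndices m W ↔ point m i ∈ W := by
  simp [subspaceIndices]

/-- The initial segments of the indices are the sets of indices of coordinate subspaces. -/
lemma exists_initialIndices_eq {l : ℕ} (hl : l < m) :
    ∃ W : Submodule (ZMod 2) (Fin m → ZMod 2), Module.finrank (ZMod 2) W + l = m ∧
      initialIndices m l = subspaceIndices m W := by
  -- `φ` lists the top `l` bit positions: `i + 1 < 2 ^ (m - l)` says that these bits vanish, so `W`
  -- is the kernel of the projection onto them.
  let φ : Fin l → Fin m := fun k => ⟨m - l + k, by omega⟩
  have hφ : Function.Injective φ := fun k k' h => by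
    have := congrArg Fin.val h
    simp only [φ] at this
    exact Fin.ext (by omega)
  refine ⟨LinearMap.ker (LinearMap.funLeft (ZMod 2) (ZMod 2) φ), ?_, ?_⟩
  · have h := LinearMap.finrank_range_add_finrank_ker (LinearMap.funLeft (ZMod 2) (ZMod 2) φ)
    rw [LinearMap.range_eq_top.2 (LinearMap.funLeft_surjective_of_injective _ _ φ hφ)] at h
    simp only [finrank_top, Module.finrank_fin_fun] at h
    omega
  · ext i
    rw [mem_subspaceIndices, initialIndices, Finset.mem_filter]
    simp only [Finset.mem_univ, true_and, LinearMap.mem_ker]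
    have hpos : 0 < 2 ^ (m - l) := by positivity
    constructor
    · intro hi
      funext k
      exact (point_apply_eq_zero_iff i (φ k)).2 (Nat.testBit_lt_two_pow
        ((by omega : i.val + 1 < 2 ^ (m - l)).trans_le
          (Nat.pow_le_pow_right two_pos (Nat.le_add_right _ _))))
    · intro hi
      have : i.val + 1 < 2 ^ (m - l) := by
        refine Nat.lt_pow_two_of_testBit _ fun j hj => ?_
        by_cases hjm : j < m
        · have hk := congrFun hi ⟨j - (m - l), by omega⟩
          have e : φ ⟨j - (m - l), by omega⟩ = ⟨j, hjm⟩ :=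
            Fin.ext (by simp only [φ]; omega)
          rw [LinearMap.funLeft_apply, e] at hk
          exact (point_apply_eq_zero_iff i ⟨j, hjm⟩).1 hk
        · exact Nat.testBit_lt_two_pow ((lt_two_pow_of_index i).trans_le
            (Nat.pow_le_pow_right two_pos (not_lt.1 hjm)))
      omega

/-- Averaging over the general linear group bounds the Fourier weight inside a subspace. -/
lemma sum_fourierCoeff_subspaceIndices_le {p : ℝ} {f : (Fin (2 ^ m - 1) → Bool) → Bool}
    (hf : HasGLSymmetry m f) {l : ℕ} {W : Submodule (ZMod 2) (Fin m → ZMod 2)}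
    (hW : Module.finrank (ZMod 2) W + l = m) :
    ∑ S, (if S ⊆ subspaceIndices m W then fourierCoeff p (toReal f) S ^ 2 else 0) ≤
      ∑ S : Finset (Fin (2 ^ m - 1)),
        fourierCoeff p (toReal f) S ^ 2 * (((S.card : ℝ) + 1) ^ l)⁻¹ := by
  classical
  let G := (Fin m → ZMod 2) ≃ₗ[ZMod 2] (Fin m → ZMod 2)
  let _ : Fintype G := Fintype.ofFinite G
  set c := fun S => fourierCoeff p (toReal f) S ^ 2
  set A := subspaceIndices m W
  -- Each `g` only permutes the index sets `S` and keeps their coefficients, so the sum can be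
  -- averaged over `G`.
  have hg : ∀ g : G, ∑ S, (if S ⊆ A then c S else 0) =
      ∑ S : Finset (Fin (2 ^ m - 1)), if ∀ i ∈ S, g (point m i) ∈ W then c S else 0 := fun g => by
    obtain ⟨π, hπ⟩ := exists_perm_point g
    rw [← Equiv.sum_comp (Equiv.finsetCongr π)]
    refine Finset.sum_congr rfl fun S _ => ?_
    rw [Equiv.finsetCongr_apply]
    have h1 : c (S.map π.toEmbedding) = c S := by
      simp only [c, fourierCoeff_map (hf g π hπ)]
    have h2 : S.map π.toEmbedding ⊆ A ↔ ∀ i ∈ S, g (point m i) ∈ W := by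
      rw [Finset.map_subset_iff_subset_preimage]
      simp [Finset.subset_iff, A, mem_subspaceIndices, hπ]
    rw [h1]
    simp only [h2]
  have hcount : ∀ S : Finset (Fin (2 ^ m - 1)),
      ((Finset.univ.filter fun g : G => ∀ i ∈ S, g (point m i) ∈ W).card : ℝ) ≤
        Fintype.card G * (((S.card : ℝ) + 1) ^ l)⁻¹ := fun S => by
    have h := card_linearEquiv_mem_mul_le W (l := l) (by simpa using hW)
      (S.map ⟨point m, point_injective⟩) (by simp [point_ne_zero])
    simp only [Finset.mem_map, Function.Embedding.coeFn_mk, forall_exists_index, and_imp,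
      forall_apply_eq_imp_iff₂, Finset.card_map] at h
    rw [← div_eq_mul_inv, le_div_iff₀ (by positivity)]
    exact_mod_cast h
  have hGpos : (0 : ℝ) < Fintype.card G := by
    exact_mod_cast Fintype.card_pos_iff.2 ⟨LinearEquiv.refl _ _⟩
  refine le_of_mul_le_mul_left ?_ hGpos
  calc (Fintype.card G : ℝ) * ∑ S, (if S ⊆ A then c S else 0)
      = ∑ g : G, ∑ S : Finset (Fin (2 ^ m - 1)),
          if ∀ i ∈ S, g (point m i) ∈ W then c S else 0 := by
        rw [← Finset.sum_congr rfl fun g _ => hg g]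
        simp
    _ = ∑ S : Finset (Fin (2 ^ m - 1)),
          ((Finset.univ.filter fun g : G => ∀ i ∈ S, g (point m i) ∈ W).card : ℝ) * c S := by
        rw [Finset.sum_comm]
        refine Finset.sum_congr rfl fun S _ => ?_
        rw [← Finset.sum_filter, Finset.sum_const, nsmul_eq_mul]
    _ ≤ ∑ S, Fintype.card G * (((S.card : ℝ) + 1) ^ l)⁻¹ * c S :=
        Finset.sum_le_sum fun S _ => mul_le_mul_of_nonneg_right (hcount S) (sq_nonneg _)
    _ = _ := by
        rw [Finset.mul_sum]
        exact Finset.sum_congr rfl fun S _ => by ring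

end Points

end BooleanCube

namespace BooleanCube

/-! ### Splitting the Fourier weight by level. -/

variable {n : ℕ} {p : ℝ}

lemma fourierCoeff_empty (f : (Fin n → Bool) → ℝ) : fourierCoeff p f ∅ = expect p f := by
  simp [fourierCoeff_eq_expect, basisFun]

/-- The low levels of a Boolean function of mean `α` carry Fourier weight at most `α ^ (7 / 6)`. -/
lemma sum_fourierCoeff_sq_low_le (hp0 : 0 < p) (hp1 : p < 1) (f : (Fin n → Bool) → Bool)
    {α lam : ℝ} (hα : α = expect p (toReal f)) (hα0 : 0 < α) (hlam : lam = min p (1 - p))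
    (P : Finset (Finset (Fin n)))
    (hP : ∀ S ∈ P, (S.card : ℝ) ≤ 1 / (8 * Real.log (1 / lam)) * Real.log (1 / α)) :
    ∑ S ∈ P, fourierCoeff p (toReal f) S ^ 2 ≤ α * α ^ (1 / 6 : ℝ) := by
  have h1p : 0 < 1 - p := sub_pos.2 hp1
  have hα1 : α ≤ 1 := hα ▸ expect_toReal_le_one hp0 hp1 f
  have hl0 : 0 < lam := hlam ▸ lt_min hp0 h1p
  have hl2 : lam ≤ 1 / 2 := by
    rcases le_total p (1 - p) with h | h
    · rw [hlam, min_eq_left h]; linarith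
    · rw [hlam, min_eq_right h]; linarith
  have hL : 0 < Real.log (1 / lam) := Real.log_pos (by rw [lt_div_iff₀ hl0]; linarith)
  have ht : 4 ≤ (lam ^ 2)⁻¹ := by
    rw [le_inv_comm₀ (by norm_num) (by positivity)]
    nlinarith
  -- The constant 8 in `c` is used here: `λ ^ (-2|S|) ≤ λ ^ (-2K) = α ^ (-1/4)`.
  have hM : ∀ S ∈ P, ((lam ^ 2)⁻¹) ^ S.card ≤ α ^ (-(1 / 4) : ℝ) := fun S hS => by
    have h := mul_le_mul_of_nonneg_right (hP S hS) (mul_pos two_pos hL).le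
    rw [← Real.log_le_log_iff (by positivity) (by positivity), Real.log_pow, Real.log_rpow hα0,
      Real.log_inv, Real.log_pow]
    have e : 1 / (8 * Real.log (1 / lam)) * Real.log (1 / α) * (2 * Real.log (1 / lam)) =
        1 / 4 * Real.log (1 / α) := by
      field_simp
      ring
    rw [e] at h
    simp only [one_div, Real.log_inv] at h
    push_cast
    linarith
  have h := sum_fourierCoeff_sq_sq_le hp0 hp1 ht (bitWeight_bitChar_pow_four_le hp0 hp1 hlam)
    f P hM
  rw [← hα] at h
  refine abs_le_of_sq_le_sq' (h.trans ?_) (by positivity) |>.2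
  have e1 : α ^ 3 * (α ^ (-(1 / 4) : ℝ)) ^ 2 = α ^ (5 / 2 : ℝ) := by
    rw [← Real.rpow_natCast, ← Real.rpow_natCast, ← Real.rpow_mul hα0.le, ← Real.rpow_add hα0]
    norm_num
  have e2 : (α * α ^ (1 / 6 : ℝ)) ^ 2 = α ^ (7 / 3 : ℝ) := by
    rw [← Real.rpow_one_add' hα0.le (by norm_num), ← Real.rpow_natCast, ← Real.rpow_mul hα0.le]
    norm_num
  rw [e1, e2]
  -- The level inequality gives exponent `5/2` for the square; `7/3` suffices since `α ≤ 1`.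
  exact Real.rpow_le_rpow_of_exponent_ge hα0 hα1 (by norm_num)

lemma sum_fourierCoeff_restriction_subspaceIndices_le {m : ℕ} (hp0 : 0 < p) (hp1 : p < 1)
    {f : (Fin (2 ^ m - 1) → Bool) → Bool} (hf : HasGLSymmetry m f) {α lam c : ℝ}
    (hα : α = expect p (toReal f)) (hlam : lam = min p (1 - p))
    (hc : c = 1 / (8 * Real.log (1 / lam))) {l : ℕ}
    {W : Submodule (ZMod 2) (Fin m → ZMod 2)} (hW : Module.finrank (ZMod 2) W + l = m) :
    ∑ S, fourierCoeff p (restriction p (subspaceIndices m W) (toReal f)) S ^ 2 ≤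
      α ^ 2 + α * ((2 : ℝ) ^ (-(l : ℤ)) * α ^ (1 / 6 : ℝ)
        + (c * Real.log (1 / α)) ^ (-(l : ℤ))) := by
  classical
  simp only [zpow_neg, zpow_natCast]
  have hα0 : 0 ≤ α := hα ▸ expect_toReal_nonneg hp0 hp1 f
  have hα1 : α ≤ 1 := hα ▸ expect_toReal_le_one hp0 hp1 f
  have hl0 : 0 < lam := hlam ▸ lt_min hp0 (sub_pos.2 hp1)
  have hl1 : lam < 1 := hlam ▸ (min_le_left _ _).trans_lt hp1
  have hL : 0 < Real.log (1 / lam) := Real.log_pos (by rw [lt_div_iff₀ hl0]; linarith)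
  have hc0 : 0 < c := by rw [hc]; positivity
  have hbessel : ∀ P : Finset (Finset (Fin (2 ^ m - 1))),
      ∑ S ∈ P, fourierCoeff p (toReal f) S ^ 2 ≤ α := fun P => by
    refine (sum_fourierCoeff_sq_le hp0 hp1 _ P).trans_eq ?_
    rw [hα]; congr 1; funext x; exact toReal_sq f x
  rw [sum_fourierCoeff_restriction_sq hp0 hp1]
  set K := c * Real.log (1 / α) with hK
  have hlog : 0 ≤ Real.log (1 / α) := by
    rw [one_div, Real.log_inv]
    exact neg_nonneg.2 (Real.log_nonpos hα0 hα1)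
  -- For `α` equal to 0 or 1, `K = 0` and its inverse takes the default value 0. Bessel alone
  -- suffices, as `α = α ^ 2` and the other term is nonnegative.
  rcases hα0.eq_or_lt with hz | hαpos
  · rw [← Finset.sum_filter]
    refine (hbessel _).trans ?_
    rw [← hz]; simp
  rcases hα1.eq_or_lt with h1 | hαlt
  · rw [← Finset.sum_filter]
    refine (hbessel _).trans ?_
    have hK0 : 0 ≤ K := mul_nonneg hc0.le hlog
    have : 0 ≤ α * ((2 ^ l)⁻¹ * α ^ (1 / 6 : ℝ) + (K ^ l)⁻¹) := by positivity
    rw [h1] at this ⊢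
    linarith
  have hKpos : 0 < K := mul_pos hc0 (Real.log_pos (by rw [lt_div_iff₀ hαpos]; linarith))
  refine (sum_fourierCoeff_subspaceIndices_le hf hW).trans ?_
  set low := (Finset.univ.erase (∅ : Finset (Fin (2 ^ m - 1)))).filter fun S => (S.card : ℝ) ≤ K
  set high := (Finset.univ.erase (∅ : Finset (Fin (2 ^ m - 1)))).filter fun S => ¬(S.card : ℝ) ≤ K
  rw [← Finset.add_sum_erase _ _ (Finset.mem_univ ∅),
    ← Finset.sum_filter_add_sum_filter_not (Finset.univ.erase ∅) fun S => (S.card : ℝ) ≤ K]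
  have h0 : fourierCoeff p (toReal f) ∅ ^ 2 *
      ((((∅ : Finset (Fin (2 ^ m - 1))).card : ℝ) + 1) ^ l)⁻¹ = α ^ 2 := by
    rw [fourierCoeff_empty, ← hα]; simp
  have hlow : ∑ S ∈ low, fourierCoeff p (toReal f) S ^ 2 * (((S.card : ℝ) + 1) ^ l)⁻¹ ≤
      α * α ^ (1 / 6 : ℝ) * (2 ^ l)⁻¹ := by
    refine (Finset.sum_le_sum (g := fun S => fourierCoeff p (toReal f) S ^ 2 * (2 ^ l)⁻¹)
      fun S hS => mul_le_mul_of_nonneg_left ?_ (sq_nonneg _)).trans ?_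
    -- Nonempty sets have `|S| + 1 ≥ 2`, the source of `2 ^ (-ℓ)`.
    · have hne : S ≠ ∅ := (Finset.mem_erase.1 (Finset.mem_filter.1 hS).1).1
      have : (1 : ℝ) ≤ S.card := by
        exact_mod_cast Finset.card_pos.2 (Finset.nonempty_of_ne_empty hne)
      gcongr
      linarith
    · rw [← Finset.sum_mul]
      refine mul_le_mul_of_nonneg_right ?_ (by positivity)
      refine sum_fourierCoeff_sq_low_le hp0 hp1 f hα hαpos hlam low fun S hS => ?_
      rw [← hc]
      exact (Finset.mem_filter.1 hS).2
  have hhigh : ∑ S ∈ high, fourierCoeff p (toReal f) S ^ 2 * (((S.card : ℝ) + 1) ^ l)⁻¹ ≤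
      α * (K ^ l)⁻¹ := by
    refine (Finset.sum_le_sum (g := fun S => fourierCoeff p (toReal f) S ^ 2 * (K ^ l)⁻¹)
      fun S hS => mul_le_mul_of_nonneg_left ?_ (sq_nonneg _)).trans ?_
    · have := not_le.1 (Finset.mem_filter.1 hS).2
      gcongr
      linarith
    · rw [← Finset.sum_mul]
      exact mul_le_mul_of_nonneg_right (hbessel _) (by positivity)
  rw [h0]
  linarith

end BooleanCube

theorem lemma13 (m : ℕ) (p : ℝ) (hp0 : 0 < p) (hp1 : p < 1)
    (f : (Fin (2 ^ m - 1) → Bool) → Bool) (hf : BooleanCube.HasGLSymmetry m f)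
    (α lam c : ℝ)
    (hα : α = BooleanCube.expect p (BooleanCube.toReal f))
    (hlam : lam = min p (1 - p))
    (hc : c = 1 / (8 * Real.log (1 / lam))) :
    (∀ ℓ : ℕ, ℓ < m →
      ∑ S : Finset (Fin (2 ^ m - 1)),
          BooleanCube.fourierCoeff p
            (BooleanCube.restriction p (BooleanCube.initialIndices m ℓ)
              (BooleanCube.toReal f)) S ^ 2
        ≤ α ^ 2 + α * ((2 : ℝ) ^ (-(ℓ : ℤ)) * α ^ (1 / 6 : ℝ)
            + (c * Real.log (1 / α)) ^ (-(ℓ : ℤ)))) ∧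
    (∀ (ℓ : ℕ) (W : Submodule (ZMod 2) (Fin m → ZMod 2)),
      Module.finrank (ZMod 2) W + ℓ = m →
      ∑ S : Finset (Fin (2 ^ m - 1)),
          BooleanCube.fourierCoeff p
            (BooleanCube.restriction p (BooleanCube.subspaceIndices m W)
              (BooleanCube.toReal f)) S ^ 2
        ≤ α ^ 2 + α * ((2 : ℝ) ^ (-(ℓ : ℤ)) * α ^ (1 / 6 : ℝ)
            + (c * Real.log (1 / α)) ^ (-(ℓ : ℤ)))) := by
  refine ⟨fun ℓ hℓ => ?_, fun ℓ W hW => ?_⟩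
  · obtain ⟨W, hW, hA⟩ := BooleanCube.exists_initialIndices_eq hℓ
    rw [hA]
    exact BooleanCube.sum_fourierCoeff_restriction_subspaceIndices_le hp0 hp1 hf hα hlam hc hW
  · exact BooleanCube.sum_fourierCoeff_restriction_subspaceIndices_le hp0 hp1 hf hα hlam hc hW
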